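/- Let $\mathbb F_q$ be a finite field with algebraic closure $\overline{\mathbb F}_q$, and let $t,n,k,d_1,\dots,d_t$ be positive integers with $1\le k\le n\le \frac{t-1}{2}$, $d_1>\cdots>d_t\ge 2$, and $\mathrm{char}(\mathbb F_q)\nmid d_i$ for $1\le i\le t$. Let $A=(a_{ji})\in\mathbb F_q^{n\times t}$ be a matrix all of whose $n\times n$ submatrices (obtained by choosing $n$ columns) have rank $n$. Let $g_1,\dots,g_n\in\mathbb F_q[X_1,\dots,X_k]$, let $$f_j:=a_{j1}X_1^{d_1}+\cdots+a_{jt}X_t^{d_t}-g_j(X_1,\dots,X_k)\in\mathbb F_q[X_1,\dots,X_t],\qquad 1\le j\le n,$$ and put $$V:=\{x\in\overline{\mathbb F}_q^{\,t}: f_1(x)=\cdots=f_n(x)=0\},\qquad C:=\Big\{x\in V:\ \mathrm{rank}\Big(\frac{\partial f_j}{\partial X_i}(x)\Big)_{1\le j\le n,\,1\le i\le t}<n\Big\}.$$ Let $K$ be a field with $\mathbb F_q\subseteq K\subseteq\overline{\mathbb F}_q$ (for instance $K=\mathbb F_q$ or $K=\overline{\mathbb F}_q$). A $K$-variety is the set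 of common zeros in $\overline{\mathbb F}_q^{\,t}$ of polynomials over $K$; the dimension of a set is the largest length $m$ of a chain $W_0\subsetneq W_1\subsetneq\cdots\subsetneq W_m$ of nonempty irreducible $K$-varieties contained in it ($-\infty$ if there is none). The singular locus of $V$ is the set of $x\in V$ such that the dimension of the tangent space $\{v\in\overline{\mathbb F}_q^{\,t}:\sum_i \frac{\partial p}{\partial X_i}(x)v_i=0 \text{ for all } p\in K[X_1,\dots,X_t] \text{ vanishing on } V\}$ differs from the maximum of the dimensions of the irreducible $K$-components of $V$ containing $x$. Then: 1. If $0<\deg(g_j)<d_t$ for all $1\le j\le n$, then $\dim C\le k-1$, and the singular locus of $V$ has dimension at most $k-1$. 2. If $g_j\in\mathbb F_q$ for all $1\le j\le n$, then $\dim C\le 0$, and the singular locus of $V$ has dimension at most $0$. -/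

import Mathlib

/-! Affine varieties are sets of points with coordinates in a field `L` (algebraically closed in the
theorem), cut out by polynomials with coefficients in a subfield `K`. -/

namespace DiagonalSystem

section Varieties

variable (K : Type*) {L : Type*} [Field K] [Field L] [Algebra K L] {r : ℕ}

/-- `W` is an affine `K`-variety: the set of common zeros in `L^r` of polynomials over `K`. -/
def IsVariety (W : Set (Fin r → L)) : Prop :=
  ∃ I : Ideal (MvPolynomial (Fin r) K), W = MvPolynomial.zeroLocus L I

/-- `W` is a nonempty irreducible affine `K`-variety. -/
def IsIrredVariety (W : Set (Fin r → L)) : Prop :=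
  IsVariety K W ∧ W.Nonempty ∧
    ∀ W₁ W₂ : Set (Fin r → L), IsVariety K W₁ → IsVariety K W₂ → W = W₁ ∪ W₂ → W = W₁ ∨ W = W₂

/-- The dimension of `V`: the supremum of the lengths of strict chains of nonempty irreducible
`K`-varieties contained in `V` (it is `⊥` if `V` contains none). -/
noncomputable def dim (V : Set (Fin r → L)) : WithBot ℕ∞ :=
  Order.krullDim {W : Set (Fin r → L) // IsIrredVariety K W ∧ W ⊆ V}

/-- `Z` is an irreducible `K`-component of `V`. -/
def IsComponent (V Z : Set (Fin r → L)) : Prop :=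
  Maximal (fun W => IsIrredVariety K W ∧ W ⊆ V) Z

/-- The dimension of `V` at `x`: the maximum of the dimensions of the irreducible `K`-components
of `V` that contain `x`. -/
noncomputable def dimAt (V : Set (Fin r → L)) (x : Fin r → L) : WithBot ℕ∞ :=
  ⨆ Z : {Z : Set (Fin r → L) // IsComponent K V Z ∧ x ∈ Z}, dim K Z.1

/-- The tangent space to `V` at `x`: the vectors killed by the differentials at `x` of all
polynomials of the defining ideal `I(V)` (for `x ∈ V` it suffices to take generators of `I(V)`,
so this is the kernel of the Jacobian matrix of any system of generators). -/
noncomputable def tangentSpace (V : Set (Fin r → L)) (x : Fin r → L) : Submodule L (Fin r → L) where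
  carrier := {v | ∀ p ∈ MvPolynomial.vanishingIdeal K V,
    ∑ i, MvPolynomial.aeval x (MvPolynomial.pderiv i p) * v i = 0}
  add_mem' := by
    intro v w hv hw p hp
    simp only [Pi.add_apply, mul_add, Finset.sum_add_distrib, hv p hp, hw p hp, add_zero]
  zero_mem' := by
    intro p _
    simp
  smul_mem' := by
    intro c v hv p hp
    have h : ∑ i, MvPolynomial.aeval x (MvPolynomial.pderiv i p) * (c • v) i
        = c * ∑ i, MvPolynomial.aeval x (MvPolynomial.pderiv i p) * v i := by
      rw [Finset.mul_sum]
      exact Finset.sum_congr rfl fun i _ => by simp only [Pi.smul_apply, smul_eq_mul]; ring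
    rw [h, hv p hp, mul_zero]

/-- The singular locus of `V`: the points `x ∈ V` with `dim T_x V ≠ dim_x V`. -/
def singularLocus (V : Set (Fin r → L)) : Set (Fin r → L) :=
  {x ∈ V | ((Module.finrank L (tangentSpace K V x) : ℕ) : WithBot ℕ∞) ≠ dimAt K V x}

end Varieties

section System

variable {F : Type*} [Field F] {n t k : ℕ}

/-- `f_j = a_{j1} X_1^{d_1} + ⋯ + a_{jt} X_t^{d_t} - g_j(X_1, …, X_k)`. -/
noncomputable def poly (hkt : k ≤ t) (A : Matrix (Fin n) (Fin t) F) (d : Fin t → ℕ)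
    (g : Fin n → MvPolynomial (Fin k) F) (j : Fin n) : MvPolynomial (Fin t) F :=
  (∑ i, MvPolynomial.C (A j i) * MvPolynomial.X i ^ d i) - MvPolynomial.rename (Fin.castLE hkt) (g j)

variable (L : Type*) [Field L] [Algebra F L]

/-- The common zeros in `L^t` of a finite family of polynomials. -/
def zeros (f : Fin n → MvPolynomial (Fin t) F) : Set (Fin t → L) :=
  {x | ∀ j, MvPolynomial.aeval x (f j) = 0}

variable {L} in
/-- The Jacobian matrix `(∂ f_j / ∂ X_i)` at the point `x`. -/
noncomputable def jacobian (f : Fin n → MvPolynomial (Fin t) F) (x : Fin t → L) :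
    Matrix (Fin n) (Fin t) L :=
  Matrix.of fun j i => MvPolynomial.aeval x (MvPolynomial.pderiv i (f j))

/-- The common zeros at which the Jacobian matrix has rank less than `n`. -/
def degeneracyLocus (f : Fin n → MvPolynomial (Fin t) F) : Set (Fin t → L) :=
  {x ∈ zeros L f | (jacobian f x).rank < n}

end System

end DiagonalSystem

namespace DiagonalSystem

/-! Let `W` be an irreducible subvariety of the degeneracy locus. If `n` of the coordinates beyond
the first `k` were not identically zero on `W`, primality of `I(W)` would give a point of `W` where
all `n` are nonzero. There the corresponding Jacobian columns are columns of `A` times nonzero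
scalars, so the rank is `n`, a contradiction. Hence all but at most `n + k - 1` coordinates vanish
on `W`.

Inverting an `n × n` submatrix of `A` expresses `n` pure powers `x_i ^ d i` by polynomials of
smaller degree in those `n` coordinates, the others being treated as coefficients. The coordinate
ring is thus finite over a polynomial ring in the remaining variables
(`ringKrullDim_le_card_of_solution`), which leaves dimension at most `k - 1` for `W`.

Singular points are degenerate. Where the rank is `n`, the tangent space is the kernel of the
Jacobian, of dimension `t - n` (`tangentSpace_zeros_eq_ker`). The local dimension is also `t - n`,
bounded below by Krull's height theorem and above by the same finiteness argument.

Constants `g_j` are covered by the case of one variable, `k = 1`. -/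

open MvPolynomial

/-! ### Finiteness, integrality and heights of points. -/

section CommutativeAlgebra

/-- A monomial of degree greater than `∑ i, d i` contains some `y i ^ d i`; replacing this factor by
`p i` lowers the degree. Hence the monomials of degree at most `∑ i, d i` span `B`. -/
theorem finite_of_pow_eq_aeval {R B ι : Type*} [CommRing R] [CommRing B] [Algebra R B] [Fintype ι]
    (y : ι → B) (hy : Function.Surjective (aeval (R := R) y)) (d : ι → ℕ)
    (p : ι → MvPolynomial ι R) (hp : ∀ i, (p i).totalDegree < d i)
    (h : ∀ i, y i ^ d i = aeval y (p i)) : Module.Finite R B := by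
  classical
  let M : Submodule R B :=
    (restrictTotalDegree ι R (∑ i, d i)).map (aeval (R := R) y).toLinearMap
  have key : ∀ N : ℕ, ∀ q : MvPolynomial ι R, q.totalDegree ≤ N → aeval y q ∈ M := by
    intro N
    induction N using Nat.strong_induction_on with
    | _ N ih =>
      intro q hq
      rw [q.as_sum, map_sum]
      refine Submodule.sum_mem _ fun m hm => ?_
      have hmN : (m.sum fun _ e => e) ≤ N := (le_totalDegree hm).trans hq
      by_cases hsmall : (m.sum fun _ e => e) ≤ ∑ i, d i
      · refine Submodule.mem_map.2 ⟨monomial m (q.coeff m), ?_, rfl⟩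
        rw [mem_restrictTotalDegree]
        exact (totalDegree_monomial_le _ _).trans hsmall
      · obtain ⟨i, hi⟩ : ∃ i, d i ≤ m i := by
          by_contra! hcon
          apply hsmall
          rw [Finsupp.sum_fintype _ _ (fun _ => rfl)]
          exact Finset.sum_le_sum fun i _ => (hcon i).le
        have hle : Finsupp.single i (d i) ≤ m := by
          rwa [Finsupp.single_le_iff]
        have hsplit : m = (m - Finsupp.single i (d i)) + Finsupp.single i (d i) :=
          (tsub_add_cancel_of_le hle).symm
        have hdeg : (m.sum fun _ e => e) =
            ((m - Finsupp.single i (d i)).sum fun _ e => e) + d i := by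
          conv_lhs => rw [hsplit]
          rw [Finsupp.sum_add_index' (fun _ => rfl) (fun _ _ _ => rfl),
            Finsupp.sum_single_index rfl]
        have heq : aeval y (monomial m (q.coeff m)) =
            aeval y (monomial (m - Finsupp.single i (d i)) (q.coeff m) * p i) := by
          rw [map_mul, ← h i]
          conv_lhs => rw [hsplit, monomial_add_single]
          rw [map_mul, map_pow, aeval_X, ← hsplit]
        rw [heq]
        have h1 := totalDegree_mul (monomial (m - Finsupp.single i (d i)) (q.coeff m)) (p i)
        have h2 : _ ≤ (m - Finsupp.single i (d i)).sum fun _ e => e :=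
          totalDegree_monomial_le (m - Finsupp.single i (d i)) (q.coeff m)
        have h3 := hp i
        exact ih (N - 1) (by omega) _ (by omega)
  have htop : M = ⊤ := by
    rw [eq_top_iff]
    rintro b -
    obtain ⟨q, rfl⟩ := hy b
    exact key _ q le_rfl
  refine ⟨htop ▸ Submodule.FG.map _ ?_⟩
  exact Module.Finite.iff_fg.1 inferInstance

/-- Incomparability: primes strictly contained in one another have distinct contractions.
Injectivity of `R → B` plays no role. -/
theorem ringKrullDim_le_of_isIntegral (R B : Type*) [CommRing R] [CommRing B] [Algebra R B]
    [Algebra.IsIntegral R B] : ringKrullDim B ≤ ringKrullDim R :=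
  Order.krullDim_le_of_strictMono (PrimeSpectrum.comap (algebraMap R B)) fun I J hIJ =>
    Ideal.IsIntegral.comap_lt_comap (R := R) (I := I.asIdeal) (J := J.asIdeal) hIJ

theorem totalDegree_aeval_le {F S σ τ : Type*} [CommRing F] [CommRing S] [Algebra F S]
    (φ : σ → MvPolynomial τ S) (hφ : ∀ i, (φ i).totalDegree ≤ 1) (g : MvPolynomial σ F) :
    (aeval φ g).totalDegree ≤ g.totalDegree := by
  classical
  conv_lhs => rw [g.as_sum, map_sum]
  refine totalDegree_finsetSum_le fun m hm => ?_
  rw [aeval_monomial]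
  refine (totalDegree_mul _ _).trans ?_
  have h1 : (algebraMap F (MvPolynomial τ S) (g.coeff m)).totalDegree = 0 := by
    rw [IsScalarTower.algebraMap_apply F S (MvPolynomial τ S), algebraMap_eq, totalDegree_C]
  rw [h1, zero_add]
  refine le_trans ?_ (le_totalDegree hm)
  refine (totalDegree_finsetProd _ _).trans (Finset.sum_le_sum fun i _ => ?_)
  exact (totalDegree_pow _ _).trans (by simpa using Nat.mul_le_mul_left (m i) (hφ i))

/-- The ideal of a point of `L^r` that is algebraic over `K` has height at least `r`. -/
theorem le_height_vanishingIdeal_singleton {K L : Type*} [Field K] [Field L] [Algebra K L]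
    [Algebra.IsAlgebraic K L] {r : ℕ} (x : Fin r → L) :
    (r : ℕ∞) ≤ (vanishingIdeal K {x}).height := by
  -- The first `m` variables are specialised to the coordinates of `x`. The kernels form a chain of
  -- primes from `e 0` to the ideal of `x`; the minimal polynomial of the next coordinate makes each
  -- inclusion strict.
  let e (m : ℕ) : MvPolynomial (Fin r) K →ₐ[K] MvPolynomial (Fin r) L :=
    aeval fun i => if (i : ℕ) < m then C (x i) else X i
  have hstep (m m' : ℕ) (h : m ≤ m') : ∃ φ : MvPolynomial (Fin r) L →ₐ[K] MvPolynomial (Fin r) L,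
      e m' = φ.comp (e m) := by
    refine ⟨(aeval (R := L) fun i : Fin r => if (i : ℕ) < m' then C (x i) else X i).restrictScalars K,
      ?_⟩
    refine MvPolynomial.algHom_ext fun i => ?_
    by_cases h1 : (i : ℕ) < m
    · simp [e, h1, h1.trans_le h, algebraMap_eq]
    · simp [e, h1]
  have hker (m : ℕ) (hm : m ≤ r) : (m : ℕ∞) ≤ (RingHom.ker (e m)).height := by
    induction m with
    | zero => simp
    | succ m ih =>
      have hlt : RingHom.ker (e m) < RingHom.ker (e (m + 1)) := by
        refine SetLike.lt_iff_le_and_exists.2 ⟨?_, ?_⟩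
        · obtain ⟨φ, hφ⟩ := hstep m (m + 1) (by omega)
          intro p hp
          rw [RingHom.mem_ker] at hp ⊢
          rw [hφ, AlgHom.comp_apply, hp, map_zero]
        · let i : Fin r := ⟨m, hm⟩
          refine ⟨Polynomial.aeval (X i) (minpoly K (x i)), ?_, ?_⟩
          · rw [RingHom.mem_ker, ← Polynomial.aeval_algHom_apply]
            have : e (m + 1) (X i) = algebraMap L (MvPolynomial (Fin r) L) (x i) := by
              simp [e, i, algebraMap_eq]
            rw [this, Polynomial.aeval_algebraMap_apply, minpoly.aeval, map_zero]
          · rw [RingHom.mem_ker, ← Polynomial.aeval_algHom_apply]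
            have : e m (X i) = X i := by simp [e, i]
            rw [this]
            intro h0
            have htr : Transcendental L (X i : MvPolynomial (Fin r) L) := transcendental_X L i
            rw [← Polynomial.aeval_map_algebraMap L] at h0
            have := (transcendental_iff.1 htr) _ h0
            rw [Polynomial.map_eq_zero] at this
            exact minpoly.ne_zero (Algebra.IsIntegral.isIntegral (x i)) this
      have hprime (m : ℕ) : (RingHom.ker (e m)).IsPrime := RingHom.ker_isPrime (e m)
      have h1 := Ideal.height_add_one_le_of_lt_of_isPrime hlt
      refine le_trans ?_ h1
      push_cast
      gcongr
      exact ih (by omega)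
  have hlast : RingHom.ker (e r) = vanishingIdeal K {x} := by
    ext p
    rw [mem_vanishingIdeal_singleton_iff, RingHom.mem_ker]
    have : e r = ((Algebra.ofId L (MvPolynomial (Fin r) L)).restrictScalars K).comp (aeval x) := by
      refine MvPolynomial.algHom_ext fun i => ?_
      simp [e, Algebra.ofId_apply, algebraMap_eq]
    rw [this, AlgHom.comp_apply]
    change C (aeval x p) = 0 ↔ _
    exact C_eq_zero
  rw [← hlast]
  exact hker r le_rfl

end CommutativeAlgebra

/-! ### Irreducible varieties, prime ideals and dimension. -/

section Varieties

variable {K L : Type*} [Field K] [Field L] [Algebra K L] {r : ℕ}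

theorem isVariety_zeroLocus (I : Ideal (MvPolynomial (Fin r) K)) :
    IsVariety K (zeroLocus L I) := ⟨I, rfl⟩

theorem IsVariety.zeroLocus_vanishingIdeal {W : Set (Fin r → L)} (h : IsVariety K W) :
    zeroLocus L (vanishingIdeal K W) = W := by
  obtain ⟨I, rfl⟩ := h
  exact (zeroLocus_anti_mono (le_vanishingIdeal_zeroLocus I)).antisymm
    (zeroLocus_vanishingIdeal_le _)

theorem IsVariety.vanishingIdeal_le_iff {W W' : Set (Fin r → L)} (h : IsVariety K W) :
    vanishingIdeal K W ≤ vanishingIdeal K W' ↔ W' ⊆ W := by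
  refine ⟨fun hle => ?_, fun hle => vanishingIdeal_anti_mono hle⟩
  rw [← h.zeroLocus_vanishingIdeal]
  exact (zeroLocus_vanishingIdeal_le W').trans (zeroLocus_anti_mono hle)

theorem IsVariety.inter_zeros {W : Set (Fin r → L)} (h : IsVariety K W)
    (p : MvPolynomial (Fin r) K) : IsVariety K {x ∈ W | aeval x p = 0} := by
  obtain ⟨I, rfl⟩ := h
  refine ⟨I ⊔ Ideal.span {p}, Set.ext fun x => ?_⟩
  have key : x ∈ zeroLocus L (I ⊔ Ideal.span {p}) ↔ I ⊔ Ideal.span {p} ≤ vanishingIdeal K {x} := by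
    rw [← le_zeroLocus_iff_le_vanishingIdeal]
    simp
  have key' : x ∈ zeroLocus L I ↔ I ≤ vanishingIdeal K {x} := by
    rw [← le_zeroLocus_iff_le_vanishingIdeal]
    simp
  rw [key, sup_le_iff, ← key', Ideal.span_singleton_le_iff_mem, mem_vanishingIdeal_singleton_iff]
  rfl

theorem IsIrredVariety.isPrime {W : Set (Fin r → L)} (h : IsIrredVariety K W) :
    (vanishingIdeal K W).IsPrime := by
  obtain ⟨hW, ⟨x, hx⟩, hirr⟩ := h
  refine Ideal.isPrime_iff.2 ⟨fun htop => ?_, fun {p q} hpq => ?_⟩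
  · have : (1 : MvPolynomial (Fin r) K) ∈ vanishingIdeal K W := htop ▸ Submodule.mem_top
    simpa using this x hx
  · have hun : W = {x ∈ W | aeval x p = 0} ∪ {x ∈ W | aeval x q = 0} := by
      ext y
      constructor
      · intro hy
        have := hpq y hy
        rw [map_mul, mul_eq_zero] at this
        exact this.imp (fun h => ⟨hy, h⟩) (fun h => ⟨hy, h⟩)
      · rintro (hy | hy) <;> exact hy.1
    rcases hirr _ _ (hW.inter_zeros p) (hW.inter_zeros q) hun with h | h
    · exact Or.inl fun y hy => (h ▸ hy : y ∈ {x ∈ W | aeval x p = 0}).2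
    · exact Or.inr fun y hy => (h ▸ hy : y ∈ {x ∈ W | aeval x q = 0}).2

theorem isIrredVariety_zeroLocus [IsAlgClosed L] (P : Ideal (MvPolynomial (Fin r) K))
    [hP : P.IsPrime] : IsIrredVariety K (zeroLocus L P) := by
  have hI : vanishingIdeal K (zeroLocus L P) = P := IsPrime.vanishingIdeal_zeroLocus P
  refine ⟨isVariety_zeroLocus P, ?_, fun W₁ W₂ h₁ h₂ hun => ?_⟩
  · rw [Set.nonempty_iff_ne_empty]
    intro h
    rw [h, vanishingIdeal_empty] at hI
    exact hP.ne_top hI.symm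
  · have hle : vanishingIdeal K W₁ ⊓ vanishingIdeal K W₂ ≤ P := by
      rw [← hI, hun]
      rintro p ⟨hp₁, hp₂⟩ x (hx | hx)
      exacts [hp₁ x hx, hp₂ x hx]
    rcases hP.inf_le.1 hle with h | h
    · left
      refine (Set.Subset.antisymm ?_ (hun ▸ Set.subset_union_left))
      rwa [← h₁.vanishingIdeal_le_iff, hI]
    · right
      refine (Set.Subset.antisymm ?_ (hun ▸ Set.subset_union_right))
      rwa [← h₂.vanishingIdeal_le_iff, hI]

/-- A chain of irreducible varieties with top `W` becomes, reversed, a chain of primes containing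
`I(W)`. -/
theorem dim_le_of_forall_ringKrullDim_le {V : Set (Fin r → L)} {N : WithBot ℕ∞}
    (h : ∀ W, IsIrredVariety K W → W ⊆ V →
      ringKrullDim (MvPolynomial (Fin r) K ⧸ vanishingIdeal K W) ≤ N) : dim K V ≤ N := by
  refine iSup_le fun p => ?_
  refine le_trans ?_ (h p.last.1 p.last.2.1 p.last.2.2)
  rw [ringKrullDim_quotient, ← Order.krullDim_orderDual]
  let q : LTSeries (PrimeSpectrum.zeroLocus
      (vanishingIdeal K p.last.1 : Set (MvPolynomial (Fin r) K)))ᵒᵈ :=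
    { length := p.length
      toFun := fun i => OrderDual.toDual ⟨⟨vanishingIdeal K (p i).1, (p i).2.1.isPrime⟩,
        vanishingIdeal_anti_mono (p.monotone (Fin.le_last i))⟩
      step := fun i => by
        have hlt : (p i.castSucc).1 ⊂ (p i.succ).1 := p.step i
        change vanishingIdeal K (p i.succ).1 < vanishingIdeal K (p i.castSucc).1
        refine lt_of_le_not_ge (vanishingIdeal_anti_mono hlt.1) fun hle => hlt.2 ?_
        exact ((p i.castSucc).2.1.1.vanishingIdeal_le_iff).1 hle }
  exact Order.LTSeries.length_le_krullDim q

/-- Krull's height theorem for varieties: through every point of a variety cut out by `n`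
polynomials in `r`-space there is a component of dimension at least `r - n`. -/
theorem exists_isComponent_le_dim [IsAlgClosed L] [Algebra.IsAlgebraic K L] {n : ℕ}
    (f : Fin n → MvPolynomial (Fin r) K) {x : Fin r → L} (hx : x ∈ zeros L f) :
    ∃ Z, IsComponent K (zeros L f) Z ∧ x ∈ Z ∧ ((r - n : ℕ) : WithBot ℕ∞) ≤ dim K Z := by
  set I : Ideal (MvPolynomial (Fin r) K) := Ideal.span (Set.range f) with hIdef
  have hV : zeros L f = zeroLocus L I := by
    rw [hIdef, zeroLocus_span]
    ext y
    simp [zeros]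
  have hIm : I ≤ vanishingIdeal K {x} := by
    rw [← le_zeroLocus_iff_le_vanishingIdeal, ← hV]
    simpa using hx
  have hheight := Ideal.height_le_height_add_encard_of_subset (Set.range f)
    (p := vanishingIdeal K {x}) (Ideal.span_le.1 hIm)
  have hcard : (Set.range f).encard ≤ n := by
    rw [← Set.image_univ]
    exact (Set.encard_image_le _ _).trans (by simp)
  have hm' : ((vanishingIdeal K {x}).map (Ideal.Quotient.mk I)).IsPrime :=
    Ideal.isPrime_map_quotientMk_of_isPrime hIm
  have hge : ((r - n : ℕ) : ℕ∞) ≤ ((vanishingIdeal K {x}).map (Ideal.Quotient.mk I)).height := by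
    have h1 : (r : ℕ∞) ≤ ((vanishingIdeal K {x}).map (Ideal.Quotient.mk I)).height + n :=
      (le_height_vanishingIdeal_singleton x).trans (hheight.trans (by gcongr))
    rw [ENat.natCast_sub]
    exact tsub_le_iff_right.2 h1
  rw [show ((vanishingIdeal K {x}).map (Ideal.Quotient.mk I)).height = Order.height
    (⟨_, hm'⟩ : PrimeSpectrum (MvPolynomial (Fin r) K ⧸ I)) from
      PrimeSpectrum.height_eq_orderHeight ⟨_, hm'⟩] at hge
  obtain ⟨p, hlast, hlen⟩ := Order.exists_series_of_le_height _ hge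
  let P (i : Fin (p.length + 1)) : Ideal (MvPolynomial (Fin r) K) :=
    (p i).asIdeal.comap (Ideal.Quotient.mk I)
  have hPprime (i) : (P i).IsPrime := Ideal.comap_isPrime _ _
  have hIP (i) : I ≤ P i := by
    intro a ha
    have h0 : Ideal.Quotient.mk I a = 0 := Ideal.Quotient.eq_zero_iff_mem.2 ha
    change Ideal.Quotient.mk I a ∈ (p i).asIdeal
    rw [h0]
    exact zero_mem _
  have hPmono : StrictMono P := by
    intro i j hij
    have := p.strictMono hij
    refine lt_of_le_not_ge (Ideal.comap_mono this.le) fun hle => this.not_ge ?_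
    exact (Ideal.comap_le_comap_iff_of_surjective _ Ideal.Quotient.mk_surjective _ _).1 hle
  have hPlast : P (Fin.last _) ≤ vanishingIdeal K {x} := by
    have h1 : (p (Fin.last _)).asIdeal = (vanishingIdeal K {x}).map (Ideal.Quotient.mk I) :=
      congrArg PrimeSpectrum.asIdeal hlast
    change (p (Fin.last _)).asIdeal.comap (Ideal.Quotient.mk I) ≤ _
    rw [h1, Ideal.comap_map_of_surjective _ Ideal.Quotient.mk_surjective,
      ← RingHom.ker_eq_comap_bot, Ideal.mk_ker]
    exact sup_le le_rfl hIm
  -- A minimal prime of `I` below the whole chain defines the component; the zero loci of the chain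
  -- lie in it.
  obtain ⟨Q, hQ, hQP⟩ := Ideal.exists_minimalPrimes_le (hIP 0)
  have hQprime : Q.IsPrime := hQ.1.1
  have hQall (i) : Q ≤ P i := hQP.trans (hPmono.monotone (Fin.zero_le i))
  refine ⟨zeroLocus L Q, ⟨⟨isIrredVariety_zeroLocus Q, ?_⟩, ?_⟩, ?_, ?_⟩
  · rw [hV]
    exact zeroLocus_anti_mono hQ.1.2
  · rintro W ⟨hW, hWV⟩ hle
    have h1 : vanishingIdeal K W ≤ Q := by
      rw [← IsPrime.vanishingIdeal_zeroLocus (K := L) Q]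
      exact vanishingIdeal_anti_mono hle
    have h2 : I ≤ vanishingIdeal K W := by
      rw [← le_zeroLocus_iff_le_vanishingIdeal, ← hV]
      exact hWV
    have h3 : Q ≤ vanishingIdeal K W := hQ.2 ⟨hW.isPrime, h2⟩ h1
    exact le_zeroLocus_iff_le_vanishingIdeal.2 h3
  · have := le_zeroLocus_iff_le_vanishingIdeal.2 ((hQall (Fin.last _)).trans hPlast)
    simpa using this
  · rw [← hlen, dim, ← Order.krullDim_orderDual]
    let q : LTSeries {W : Set (Fin r → L) // IsIrredVariety K W ∧ W ⊆ zeroLocus L Q}ᵒᵈ :=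
      { length := p.length
        toFun := fun i => OrderDual.toDual ⟨zeroLocus L (P i),
          isIrredVariety_zeroLocus (P i), zeroLocus_anti_mono (hQall i)⟩
        step := fun i => by
          have hlt : P i.castSucc < P i.succ := hPmono i.castSucc_lt_succ
          change zeroLocus L (P i.succ) < zeroLocus L (P i.castSucc)
          refine lt_of_le_not_ge (zeroLocus_anti_mono hlt.le) fun hle => hlt.not_ge ?_
          rw [← IsPrime.vanishingIdeal_zeroLocus (K := L) (P i.castSucc)]
          rw [← le_zeroLocus_iff_le_vanishingIdeal]
          exact hle }
    exact Order.LTSeries.length_le_krullDim q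

end Varieties

/-! ### Gradients and the Jacobian criterion. -/

section JacobianCriterion

variable {L : Type*} [Field L] {r : ℕ}

/-- The gradient of a polynomial at a point. -/
noncomputable def gradient (x : Fin r → L) : MvPolynomial (Fin r) L →ₗ[L] (Fin r → L) :=
  LinearMap.pi fun i => (aeval x).toLinearMap ∘ₗ (pderiv i).toLinearMap

theorem gradient_apply (x : Fin r → L) (p : MvPolynomial (Fin r) L) (i : Fin r) :
    gradient x p i = aeval x (pderiv i p) := rfl

/-- The affine-linear form vanishing at `x` with gradient `c`. -/
noncomputable def linearForm (x c : Fin r → L) : MvPolynomial (Fin r) L :=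
  ∑ i, C (c i) * (X i - C (x i))

theorem linearForm_mem (x c : Fin r → L) : linearForm x c ∈ vanishingIdeal L {x} := by
  rw [mem_vanishingIdeal_singleton_iff]
  simp [linearForm]

theorem gradient_linearForm (x c : Fin r → L) : gradient x (linearForm x c) = c := by
  ext i
  rw [gradient_apply, linearForm]
  simp [pderiv_X, Pi.single_apply]

/-- First-order Taylor expansion. For `p * X j` the remainder is `X j` times that of `p`, plus `X j
- C (x j)` times the linear part of `p`. -/
theorem sub_linearForm_gradient_mem (x : Fin r → L) (p : MvPolynomial (Fin r) L) :
    p - C (aeval x p) - linearForm x (gradient x p) ∈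
      vanishingIdeal L {x} * vanishingIdeal L {x} := by
  induction p using MvPolynomial.induction_on with
  | C a =>
    have : gradient x (C a) = 0 := by
      ext i
      simp [gradient_apply]
    simp [this, linearForm]
  | add p q hp hq =>
    convert! add_mem hp hq using 1
    simp only [map_add, linearForm, Pi.add_apply, add_mul, Finset.sum_add_distrib]
    ring
  | mul_X p j hp =>
    have hg : linearForm x (gradient x (p * X j)) =
        C (x j) * linearForm x (gradient x p) + C (aeval x p) * (X j - C (x j)) := by
      have h1 : gradient x (p * X j) =
          fun i => x j * gradient x p i + aeval x p * Pi.single (M := fun _ => L) j 1 i := by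
        ext i
        simp only [gradient_apply, Derivation.leibniz, smul_eq_mul, map_add, map_mul, aeval_X,
          pderiv_X, Pi.single_apply]
        rcases eq_or_ne i j with h | h
        · subst h; simp; ring
        · simp [h, h.symm]
      rw [h1]
      simp only [linearForm, map_add, map_mul, add_mul, Finset.sum_add_distrib, Finset.mul_sum,
        mul_assoc]
      congr 1
      rw [Finset.sum_eq_single j]
      · simp
      · intro b _ hb
        simp [hb]
      · simp
    have hX : (X j - C (x j) : MvPolynomial (Fin r) L) ∈ vanishingIdeal L {x} := by
      rw [mem_vanishingIdeal_singleton_iff]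
      simp
    rw [hg, map_mul, aeval_X, C_mul]
    have h1 := Ideal.mul_mem_left _ (X j) hp
    have h2 := Ideal.mul_mem_mul hX (linearForm_mem x (gradient x p))
    convert! add_mem h1 h2 using 1
    ring

theorem mem_sq_of_gradient_eq_zero {x : Fin r → L} {p : MvPolynomial (Fin r) L}
    (hp : p ∈ vanishingIdeal L {x}) (h : gradient x p = 0) :
    p ∈ vanishingIdeal L {x} * vanishingIdeal L {x} := by
  rw [mem_vanishingIdeal_singleton_iff] at hp
  have := sub_linearForm_gradient_mem x p
  rw [hp, h] at this
  simpa [linearForm] using this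

/-- At a point where the gradients of `f` are linearly independent, the gradient of a polynomial
in the radical of the ideal generated by `f` is a combination of the gradients of `f`. -/
theorem gradient_mem_span_of_mem_radical {n : ℕ} (f : Fin n → MvPolynomial (Fin r) L)
    {x : Fin r → L} (hfx : ∀ j, aeval x (f j) = 0)
    (hind : LinearIndependent L fun j => gradient x (f j)) {p : MvPolynomial (Fin r) L}
    (hp : p ∈ (Ideal.span (Set.range f)).radical) :
    gradient x p ∈ Submodule.span L (Set.range fun j => gradient x (f j)) := by
  by_contra hnot
  set W := Submodule.span L (Set.range fun j => gradient x (f j)) with hW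
  set m := vanishingIdeal L {x} with hm
  have hmmax : m.IsMaximal := inferInstance
  have hfm (j) : f j ∈ m := (mem_vanishingIdeal_singleton_iff _ _).2 (hfx j)
  have hpm : p ∈ m := by
    have : (Ideal.span (Set.range f)).radical ≤ m := by
      rw [Ideal.IsPrime.radical_le_iff inferInstance, Ideal.span_le]
      rintro _ ⟨j, rfl⟩
      exact hfm j
    exact this hp
  have hWrank : Module.finrank L W = n := by
    simpa using finrank_span_eq_card hind
  -- If the gradient of `p` were independent of those of `f`, then `D` would have dimension at most
  -- `r - n - 1`. So `f` and the linear forms from `D` number at most `r - 1`, too few to have an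
  -- ideal of height `r` as a minimal prime.
  obtain ⟨D, hD⟩ := Submodule.exists_isCompl (W ⊔ Submodule.span L {gradient x p})
  have hlt : W < W ⊔ Submodule.span L {gradient x p} := by
    refine lt_of_le_of_ne le_sup_left fun h => hnot ?_
    rw [h]
    exact Submodule.mem_sup_right (Submodule.mem_span_singleton_self _)
  have hrank := Submodule.finrank_lt_finrank_of_lt hlt
  have hsum := Submodule.finrank_add_eq_of_isCompl hD
  rw [Module.finrank_fin_fun] at hsum
  let b := Module.finBasis L D
  let ℓ (u : Fin (Module.finrank L D)) : MvPolynomial (Fin r) L := linearForm x (b u : Fin r → L)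
  let G : Set (MvPolynomial (Fin r) L) := Set.range f ∪ Set.range ℓ
  have hGfin : G.Finite := (Set.finite_range _).union (Set.finite_range _)
  have hGcard : G.ncard ≤ n + Module.finrank L D := by
    refine (Set.ncard_union_le _ _).trans (add_le_add ?_ ?_)
    · rw [← Set.image_univ]
      exact (Set.ncard_image_le Set.finite_univ).trans (by simp [Set.ncard_univ])
    · rw [← Set.image_univ]
      exact (Set.ncard_image_le Set.finite_univ).trans (by simp [Set.ncard_univ])
  have hGm : G ⊆ m := by
    rintro _ (⟨j, rfl⟩ | ⟨u, rfl⟩)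
    exacts [hfm j, linearForm_mem _ _]
  let H : Submodule L (MvPolynomial (Fin r) L) := Submodule.span L (insert p G)
  have hHtop : H.map (gradient x) = ⊤ := by
    rw [eq_top_iff, ← hD.sup_eq_top]
    refine sup_le (sup_le ?_ ?_) ?_
    · rw [hW, Submodule.span_le]
      rintro _ ⟨j, rfl⟩
      exact ⟨f j, Submodule.subset_span (Or.inr (Or.inl ⟨j, rfl⟩)), rfl⟩
    · rw [Submodule.span_le, Set.singleton_subset_iff]
      exact ⟨p, Submodule.subset_span (Or.inl rfl), rfl⟩
    · have hDspan : D = Submodule.span L (Set.range fun u => (b u : Fin r → L)) := by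
        have := congrArg (Submodule.map D.subtype) b.span_eq
        rw [Submodule.map_span, Submodule.map_top, Submodule.range_subtype, ← Set.range_comp] at this
        exact this.symm
      rw [hDspan, Submodule.span_le]
      rintro _ ⟨u, rfl⟩
      exact ⟨ℓ u, Submodule.subset_span (Or.inr (Or.inr ⟨u, rfl⟩)), gradient_linearForm _ _⟩
  have hHJ : ∀ q ∈ H, q ∈ Ideal.span (insert p G) := fun q hq =>
    Submodule.span_le_restrictScalars L (MvPolynomial (Fin r) L) _ hq
  have hJm : Ideal.span (insert p G) ≤ m := by
    rw [Ideal.span_le, Set.insert_subset_iff]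
    exact ⟨hpm, hGm⟩
  -- The gradients of `p` and `G` span the whole space, so these polynomials generate `m` modulo its
  -- square. Nakayama then gives an `a ≡ 1` modulo `m` with `a • m` inside their ideal.
  have hnak : m ≤ Ideal.span (insert p G) ⊔ m • m := by
    intro q hq
    obtain ⟨h, hh, hgrad⟩ : gradient x q ∈ H.map (gradient x) := hHtop ▸ Submodule.mem_top
    have h1 : q - h ∈ m * m := by
      refine mem_sq_of_gradient_eq_zero (sub_mem hq (hJm (hHJ h hh))) ?_
      rw [map_sub, hgrad, sub_self]
    rw [show q = h + (q - h) by ring]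
    exact Submodule.add_mem_sup (hHJ h hh) h1
  obtain ⟨a, ha, haJ⟩ := Submodule.exists_sub_one_mem_and_smul_le_of_fg_of_le_sup
    (IsNoetherian.noetherian m) le_rfl hnak
  have hmin : m ∈ (Ideal.span G).minimalPrimes := by
    refine ⟨⟨inferInstance, Ideal.span_le.2 hGm⟩, ?_⟩
    rintro Q ⟨hQ, hGQ⟩ hQm
    -- Being in the radical, `p` lies in every prime containing `f`, so it is not needed among the
    -- generators.
    have hpQ : p ∈ Q := by
      have : (Ideal.span (Set.range f)).radical ≤ Q := by
        rw [hQ.radical_le_iff]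
        exact (Ideal.span_mono Set.subset_union_left).trans hGQ
      exact this hp
    have hJQ : Ideal.span (insert p G) ≤ Q := by
      rw [Ideal.span_le, Set.insert_subset_iff]
      exact ⟨hpQ, Ideal.span_le.1 hGQ⟩
    have haQ : a ∉ Q := by
      intro haQ
      apply hmmax.ne_top
      rw [Ideal.eq_top_iff_one, show (1 : MvPolynomial (Fin r) L) = a - (a - 1) by ring]
      exact sub_mem (hQm haQ) ha
    intro q hq
    have : a * q ∈ Q := hJQ (haJ (Submodule.smul_mem_pointwise_smul q a m hq))
    exact (hQ.mem_or_mem this).resolve_left haQ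
  have hle := Ideal.height_le_card_of_mem_minimalPrimes_span hGfin hmin
  have hge : (r : ℕ∞) ≤ m.height := le_height_vanishingIdeal_singleton x
  have : r ≤ G.ncard := by exact_mod_cast hge.trans hle
  omega

end JacobianCriterion

/-! ### Dimension bounds for the diagonal system. -/

section Systems

theorem det_ne_zero_of_rank_eq {K : Type*} [Field K] {n : ℕ} {M : Matrix (Fin n) (Fin n) K}
    (h : M.rank = n) : M.det ≠ 0 := by
  rw [← isUnit_iff_ne_zero, ← Matrix.isUnit_iff_isUnit_det,
    ← Matrix.linearIndependent_rows_iff_isUnit, linearIndependent_iff_card_eq_finrank_span,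
    Set.finrank, ← Matrix.rank_eq_finrank_span_row, h, Fintype.card_fin]

theorem linearIndependent_row_of_rank_eq {K : Type*} [Field K] {n t : ℕ}
    {M : Matrix (Fin n) (Fin t) K} (h : M.rank = n) : LinearIndependent K M.row := by
  rw [linearIndependent_iff_card_eq_finrank_span, Set.finrank, ← Matrix.rank_eq_finrank_span_row,
    h, Fintype.card_fin]

variable {K : Type*} [Field K] {n t k : ℕ}

/-- If a `K`-algebra is generated by a solution of the system, then it is finite over the
subalgebra generated by the coordinates in `U`, provided the other nonzero coordinates are `n` in
number and index an invertible submatrix. -/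
theorem ringKrullDim_le_card_of_solution {B : Type*} [CommRing B] [Algebra K B] (hkt : k ≤ t)
    (A : Matrix (Fin n) (Fin t) K) (d : Fin t → ℕ) (g : Fin n → MvPolynomial (Fin k) K)
    (hd : ∀ i, 0 < d i) (hg : ∀ j i, (g j).totalDegree < d i) (x : Fin t → B)
    (hx : Function.Surjective (aeval (R := K) x)) (hf : ∀ j, aeval x (poly hkt A d g j) = 0)
    (s : Fin n ↪o Fin t) (hs : (A.submatrix id s).det ≠ 0) (U : Finset (Fin t))
    (hU : ∀ i, i ∉ U → i ∉ Set.range s → x i = 0) :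
    ringKrullDim B ≤ U.card := by
  classical
  let R := MvPolynomial U K
  let _ : Algebra R B := (aeval (R := K) fun u : U => x u).toRingHom.toAlgebra
  have halg (q : R) : algebraMap R B q = aeval (fun u : U => x u) q := rfl
  have : IsScalarTower K R B := IsScalarTower.of_algebraMap_eq fun a => by
    rw [halg, algebraMap_eq, aeval_C]
  -- Coordinates in `U` become coefficients, the other selected ones become variables, and the rest
  -- are zero.
  let φ (i : Fin t) : MvPolynomial (Fin n) R :=
    if h : i ∈ U then C (X ⟨i, h⟩) else if h : ∃ i', s i' = i then X h.choose else 0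
  let ψ : MvPolynomial (Fin n) R →ₐ[K] B := (aeval (R := R) (x ∘ s)).restrictScalars K
  have hψ (q) : ψ q = aeval (R := R) (x ∘ s) q := rfl
  have hψφ (i) : ψ (φ i) = x i := by
    rw [hψ]
    by_cases h : i ∈ U
    · simp only [φ, h, dif_pos, aeval_C]
      rw [halg, aeval_X]
    · by_cases h' : ∃ i', s i' = i
      · simp only [φ, h, h', dif_pos, dif_neg, not_false_iff, aeval_X, Function.comp_apply]
        rw [h'.choose_spec]
      · simp only [φ, h, h', dif_neg, not_false_iff, map_zero]
        exact (hU i h h').symm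
  have hψφ' (q : MvPolynomial (Fin t) K) : ψ (aeval φ q) = aeval x q := by
    rw [← AlgHom.comp_apply]
    congr 1
    refine MvPolynomial.algHom_ext fun i => ?_
    simp [hψφ]
  have hφdeg (i) : (φ i).totalDegree ≤ 1 := by
    by_cases h : i ∈ U
    · simp [φ, h]
    · by_cases h' : ∃ i', s i' = i
      · simp only [φ, h, h', dif_pos, dif_neg, not_false_iff]
        exact (totalDegree_X _).le
      · simp [φ, h, h']
  have hφdeg' (i) (hi : i ∉ Set.range s) : (φ i).totalDegree = 0 := by
    by_cases h : i ∈ U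
    · simp [φ, h]
    · have h' : ¬ ∃ i', s i' = i := hi
      simp only [φ, h, h', dif_neg, not_false_iff, totalDegree_zero]
  let c : Matrix (Fin n) (Fin n) K := (A.submatrix id s)⁻¹
  have hc : c * A.submatrix id s = 1 := Matrix.nonsing_inv_mul _ (isUnit_iff_ne_zero.2 hs)
  let S : Finset (Fin t) := Finset.univ.map s.toEmbedding
  have hS (i) : i ∈ S ↔ i ∈ Set.range s := by simp [S]
  -- The system solved for the selected powers. The degree drops below `d (s i)` because each `g j`
  -- has degree below every exponent and the unselected powers are constants over `R`.
  let p (i : Fin n) : MvPolynomial (Fin n) R :=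
    ∑ j, c i j • (aeval φ (rename (Fin.castLE hkt) (g j)) - ∑ l ∈ Sᶜ, A j l • φ l ^ d l)
  have hpdeg (i) : (p i).totalDegree < d (s i) := by
    refine Nat.lt_of_le_pred (hd _) ?_
    refine totalDegree_finsetSum_le fun j _ => (totalDegree_smul_le _ _).trans ?_
    refine (totalDegree_sub _ _).trans (max_le ?_ ?_)
    · refine ((totalDegree_aeval_le φ hφdeg _).trans (totalDegree_rename_le _ _)).trans ?_
      exact Nat.le_pred_of_lt (hg j _)
    · refine totalDegree_finsetSum_le fun l hl => (totalDegree_smul_le _ _).trans ?_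
      refine (totalDegree_pow _ _).trans ?_
      rw [hφdeg' l (fun h => Finset.mem_compl.1 hl ((hS l).2 h)), mul_zero]
      exact Nat.zero_le _
  have hsys (j) : aeval x (rename (Fin.castLE hkt) (g j)) - ∑ l ∈ Sᶜ, A j l • x l ^ d l =
      ∑ i, A j (s i) • x (s i) ^ d (s i) := by
    have h0 := hf j
    rw [poly, map_sub, map_sum, sub_eq_zero] at h0
    rw [← h0, ← Finset.sum_add_sum_compl S]
    simp [S, Algebra.smul_def]
  have hpow (i) : (x ∘ s) i ^ d (s i) = aeval (R := R) (x ∘ s) (p i) := by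
    rw [← hψ]
    simp only [p, map_sum, map_smul, map_sub, map_pow, hψφ, hψφ', hsys]
    simp only [Finset.smul_sum, smul_smul]
    rw [Finset.sum_comm]
    simp only [← Finset.sum_smul]
    have hent (i') : ∑ j, c i j * A j (s i') = (1 : Matrix (Fin n) (Fin n) K) i i' := by
      rw [← hc]
      rfl
    simp only [hent, Matrix.one_apply, ite_smul, one_smul, zero_smul]
    simp
  have hsurj : Function.Surjective (aeval (R := R) (x ∘ s)) := fun b => by
    obtain ⟨q, rfl⟩ := hx b
    exact ⟨aeval φ q, hψφ' q⟩
  have : Module.Finite R B :=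
    finite_of_pow_eq_aeval (x ∘ s) hsurj (fun i => d (s i)) p hpdeg hpow
  refine (ringKrullDim_le_of_isIntegral R B).trans ?_
  simp [R]

theorem ringKrullDim_quotient_le_of_poly_mem (hkt : k ≤ t)
    (A : Matrix (Fin n) (Fin t) K) (d : Fin t → ℕ) (g : Fin n → MvPolynomial (Fin k) K)
    (hd : ∀ i, 0 < d i) (hg : ∀ j i, (g j).totalDegree < d i)
    (hA : ∀ s : Fin n ↪o Fin t, (A.submatrix id s).det ≠ 0)
    (I : Ideal (MvPolynomial (Fin t) K)) (hI : ∀ j, poly hkt A d g j ∈ I)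
    (T : Finset (Fin t)) (hT : ∀ i, i ∉ T → X i ∈ I) (hn : n ≤ T.card) :
    ringKrullDim (MvPolynomial (Fin t) K ⧸ I) ≤ ((T.card - n : ℕ) : WithBot ℕ∞) := by
  classical
  obtain ⟨S, hST, hS⟩ := Finset.exists_subset_card_eq hn
  have haeval (q : MvPolynomial (Fin t) K) :
      aeval (fun i => Ideal.Quotient.mk I (X i)) q = Ideal.Quotient.mk I q := by
    exact (DFunLike.congr_fun (aeval_unique (Ideal.Quotient.mkₐ K I)) q).symm
  have hmem (i) : i ∈ Set.range (S.orderEmbOfFin hS) ↔ i ∈ S := by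
    rw [Finset.range_orderEmbOfFin, Finset.mem_coe]
  rw [← hS, ← Finset.card_sdiff_of_subset hST]
  refine ringKrullDim_le_card_of_solution hkt A d g hd hg (fun i => Ideal.Quotient.mk I (X i)) ?_ ?_
    (S.orderEmbOfFin hS) (hA _) (T \ S) ?_
  · intro b
    obtain ⟨q, rfl⟩ := Ideal.Quotient.mk_surjective b
    exact ⟨q, haeval q⟩
  · intro j
    rw [haeval, Ideal.Quotient.eq_zero_iff_mem]
    exact hI j
  · intro i hi hi'
    rw [hmem] at hi'
    rw [Ideal.Quotient.eq_zero_iff_mem]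
    exact hT i fun h => hi (Finset.mem_sdiff.2 ⟨h, hi'⟩)

variable {L : Type*} [Field L] [Algebra K L]

/-- The `g j` involve only the first `k` variables, so the chosen columns are those of `A` scaled by
`d i * x i ^ (d i - 1)`. -/
theorem rank_jacobian_eq (hkt : k ≤ t) (A : Matrix (Fin n) (Fin t) K) (d : Fin t → ℕ)
    (g : Fin n → MvPolynomial (Fin k) K) (hd : ∀ i, (d i : K) ≠ 0) (x : Fin t → L)
    (s : Fin n ↪o Fin t) (hs : (A.submatrix id s).det ≠ 0) (hks : ∀ i, k ≤ s i)
    (hxs : ∀ i, x (s i) ≠ 0) : (jacobian (poly hkt A d g) x).rank = n := by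
  classical
  have hmat : (jacobian (poly hkt A d g) x).submatrix id s =
      (A.submatrix id s).map (algebraMap K L) *
        Matrix.diagonal fun i => (d (s i) : L) * x (s i) ^ (d (s i) - 1) := by
    ext j i
    have hren : pderiv (s i) (rename (Fin.castLE hkt) (g j)) = 0 := by
      refine pderiv_eq_zero_of_notMem_vars fun h => ?_
      have := vars_rename (Fin.castLE hkt) (g j) h
      obtain ⟨a, -, ha⟩ := Finset.mem_image.1 this
      have h1 := hks i
      rw [← ha, Fin.val_castLE] at h1
      exact absurd a.2 (by omega)
    rw [Matrix.mul_diagonal, Matrix.submatrix_apply, id_eq, jacobian, Matrix.of_apply, poly, map_sub,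
      hren, sub_zero, map_sum, map_sum, Finset.sum_eq_single (s i)]
    · simp [Derivation.leibniz_pow]
    · intro b _ hb
      simp [Derivation.leibniz_pow, pderiv_X, hb.symm]
    · simp
  have hdet : ((jacobian (poly hkt A d g) x).submatrix id s).det ≠ 0 := by
    rw [hmat, Matrix.det_mul, Matrix.det_diagonal]
    refine mul_ne_zero ?_ (Finset.prod_ne_zero_iff.2 fun i _ => mul_ne_zero ?_ (pow_ne_zero _ (hxs i)))
    · have := RingHom.map_det (algebraMap K L) (A.submatrix id s)
      rw [RingHom.mapMatrix_apply] at this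
      rw [← this]
      simpa using hs
    · rw [← map_natCast (algebraMap K L)]
      exact (map_ne_zero _).2 (hd (s i))
  refine le_antisymm ?_ ?_
  · simpa using (jacobian (poly hkt A d g) x).rank_le_card_height
  · have h1 := Matrix.rank_of_det_ne_zero hdet
    rw [Fintype.card_fin] at h1
    exact h1.symm.le.trans (Matrix.rank_submatrix_le _ _ _)

theorem dim_degeneracyLocus_le (hk : 1 ≤ k) (hkt : k ≤ t) (hnt : n + k - 1 ≤ t)
    (A : Matrix (Fin n) (Fin t) K) (d : Fin t → ℕ)
    (g : Fin n → MvPolynomial (Fin k) K) (hd : ∀ i, (d i : K) ≠ 0)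
    (hg : ∀ j i, (g j).totalDegree < d i)
    (hA : ∀ s : Fin n ↪o Fin t, (A.submatrix id s).det ≠ 0) :
    dim K (degeneracyLocus L (poly hkt A d g)) ≤ ((k - 1 : ℕ) : WithBot ℕ∞) := by
  classical
  refine dim_le_of_forall_ringKrullDim_le fun W hW hWC => ?_
  have hprime := hW.isPrime
  let N : Finset (Fin t) := {i | k ≤ (i : ℕ) ∧ X i ∉ vanishingIdeal K W}
  have hN : N.card < n := by
    by_contra! hcon
    obtain ⟨S, hSN, hS⟩ := Finset.exists_subset_card_eq hcon
    have hprod : ∏ i ∈ S, X i ∉ vanishingIdeal K W := by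
      rw [hprime.prod_mem_iff]
      rintro ⟨i, hi, hiW⟩
      exact (Finset.mem_filter.1 (hSN hi)).2.2 hiW
    obtain ⟨x, hxW, hx⟩ : ∃ x ∈ W, aeval x (∏ i ∈ S, (X i : MvPolynomial (Fin t) K)) ≠ 0 := by
      by_contra! h
      exact hprod h
    rw [map_prod, Finset.prod_ne_zero_iff] at hx
    refine (hWC hxW).2.ne (rank_jacobian_eq hkt A d g hd x (S.orderEmbOfFin hS) (hA _) ?_ ?_)
    · intro i
      exact (Finset.mem_filter.1 (hSN (Finset.orderEmbOfFin_mem S hS i))).2.1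
    · intro i
      simpa using hx _ (Finset.orderEmbOfFin_mem S hS i)
  let M : Finset (Fin t) := Finset.univ.map (Fin.castLEEmb hkt)
  have hM : M.card = k := by simp [M]
  have hcard : (M ∪ N).card ≤ n + k - 1 := by
    have := Finset.card_union_le M N
    omega
  -- Padding to exactly `n + k - 1` coordinates, at least `n` since `k ≥ 1`, allows `n` of them to
  -- be eliminated.
  obtain ⟨T, hT, hTcard⟩ := Finset.exists_superset_card_eq hcard (by simpa using hnt)
  have hd0 (i) : 0 < d i := Nat.pos_of_ne_zero fun h => hd i (by simp [h])
  have := ringKrullDim_quotient_le_of_poly_mem hkt A d g hd0 hg hA (vanishingIdeal K W)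
    (fun j x hx => (hWC hx).1 j) T ?_ (by omega)
  · rwa [hTcard, show n + k - 1 - n = k - 1 by omega] at this
  · intro i hi
    by_contra hX
    refine hi (hT ?_)
    rcases lt_or_ge (i : ℕ) k with h | h
    · exact Finset.mem_union_left _ (Finset.mem_map.2 ⟨⟨i, h⟩, Finset.mem_univ _, rfl⟩)
    · exact Finset.mem_union_right _ (Finset.mem_filter.2 ⟨Finset.mem_univ _, h, hX⟩)

theorem tangentSpace_zeros_eq_ker [IsAlgClosed L] (f : Fin n → MvPolynomial (Fin t) K)
    {x : Fin t → L} (hx : x ∈ zeros L f) (hrank : (jacobian f x).rank = n) :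
    tangentSpace K (zeros L f) x = LinearMap.ker (jacobian f x).mulVecLin := by
  have hgrad (q : MvPolynomial (Fin t) K) (i) :
      gradient x (map (algebraMap K L) q) i = aeval x (pderiv i q) := by
    rw [gradient_apply, pderiv_map, aeval_map_algebraMap]
  let f' (j) : MvPolynomial (Fin t) L := map (algebraMap K L) (f j)
  have hV : zeros L f = zeroLocus L (Ideal.span (Set.range f')) := by
    rw [zeroLocus_span]
    ext y
    simp only [zeros, f', Set.mem_ofPred_eq, Set.forall_mem_range, aeval_map_algebraMap]
  have hrow : (fun j => gradient x (f' j)) = (jacobian f x).row := by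
    ext j i
    exact hgrad (f j) i
  ext v
  rw [LinearMap.mem_ker, Matrix.mulVecLin_apply]
  constructor
  · intro hv
    ext j
    exact hv (f j) fun y hy => hy j
  · intro hv p hp
    -- The Nullstellensatz is applied over `L`, which puts `p` in the radical of the extended ideal.
    have hp' : map (algebraMap K L) p ∈ (Ideal.span (Set.range f')).radical := by
      rw [← vanishingIdeal_zeroLocus_eq_radical (K := L), ← hV]
      intro y hy
      rw [aeval_map_algebraMap]
      exact hp y hy
    have hspan := gradient_mem_span_of_mem_radical f' (x := x)
      (fun j => by simpa [f', aeval_map_algebraMap] using hx j)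
      (hrow ▸ linearIndependent_row_of_rank_eq hrank) hp'
    have hle : Submodule.span L (Set.range fun j => gradient x (f' j)) ≤
        LinearMap.ker ((dotProductBilin L L).flip v) := by
      rw [Submodule.span_le]
      rintro _ ⟨j, rfl⟩
      have hj : gradient x (f' j) = (jacobian f x).row j := congrFun hrow j
      change gradient x (f' j) ∈ LinearMap.ker _
      rw [hj]
      exact congrFun hv j
    have := hle hspan
    simp only [← hgrad]
    exact this

theorem singularLocus_subset_degeneracyLocus [IsAlgClosed L] [Algebra.IsAlgebraic K L]
    (hkt : k ≤ t) (hnt : n ≤ t) (A : Matrix (Fin n) (Fin t) K) (d : Fin t → ℕ)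
    (g : Fin n → MvPolynomial (Fin k) K) (hd : ∀ i, 0 < d i)
    (hg : ∀ j i, (g j).totalDegree < d i)
    (hA : ∀ s : Fin n ↪o Fin t, (A.submatrix id s).det ≠ 0) :
    singularLocus K (zeros L (poly hkt A d g)) ⊆ degeneracyLocus L (poly hkt A d g) := by
  rintro x ⟨hx, hne⟩
  refine ⟨hx, lt_of_le_of_ne ?_ fun hrank => hne ?_⟩
  · simpa using (jacobian (poly hkt A d g) x).rank_le_card_height
  · have hfin : Module.finrank L (tangentSpace K (zeros L (poly hkt A d g)) x) = t - n := by
      rw [tangentSpace_zeros_eq_ker _ hx hrank]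
      have := (jacobian (poly hkt A d g) x).mulVecLin.finrank_range_add_finrank_ker
      rw [Module.finrank_fin_fun] at this
      rw [Matrix.rank] at hrank
      omega
    rw [hfin]
    refine le_antisymm ?_ (iSup_le fun Z => ?_)
    · obtain ⟨Z, hZ, hxZ, hdim⟩ := exists_isComponent_le_dim _ hx
      exact hdim.trans (le_iSup (fun Z : {Z : Set (Fin t → L) //
        IsComponent K (zeros L (poly hkt A d g)) Z ∧ x ∈ Z} => dim K Z.1) ⟨Z, hZ, hxZ⟩)
    -- With all `t` coordinates allowed, eliminating `n` of them bounds every component by `t - n`.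
    · refine dim_le_of_forall_ringKrullDim_le fun W _ hWZ => ?_
      have := ringKrullDim_quotient_le_of_poly_mem hkt A d g hd hg hA (vanishingIdeal K W)
        (fun j y hy => Z.2.1.1.2 (hWZ hy) j) Finset.univ (fun i hi => absurd (Finset.mem_univ i) hi)
        (by simpa using hnt)
      simpa using this

theorem dim_mono {V V' : Set (Fin t → L)} (h : V ⊆ V') : dim K V ≤ dim K V' :=
  Order.krullDim_le_of_strictMono (fun W => ⟨W.1, W.2.1, W.2.2.trans h⟩) fun _ _ hlt => hlt

theorem dim_loci_le [IsAlgClosed L] [Algebra.IsAlgebraic K L]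
    (hk : 1 ≤ k) (hkt : k ≤ t) (hnt : n + k - 1 ≤ t) (hnt' : n ≤ t)
    (A : Matrix (Fin n) (Fin t) K) (d : Fin t → ℕ)
    (g : Fin n → MvPolynomial (Fin k) K) (hd : ∀ i, (d i : K) ≠ 0)
    (hg : ∀ j i, (g j).totalDegree < d i)
    (hA : ∀ s : Fin n ↪o Fin t, (A.submatrix id s).det ≠ 0) :
    dim K (degeneracyLocus L (poly hkt A d g)) ≤ ((k - 1 : ℕ) : WithBot ℕ∞) ∧
      dim K (singularLocus K (zeros L (poly hkt A d g))) ≤ ((k - 1 : ℕ) : WithBot ℕ∞) := by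
  have hC := dim_degeneracyLocus_le (L := L) hk hkt hnt A d g hd hg hA
  have hd0 (i) : 0 < d i := Nat.pos_of_ne_zero fun h => hd i (by simp [h])
  exact ⟨hC, (dim_mono (singularLocus_subset_degeneracyLocus hkt hnt' A d g hd0 hg hA)).trans hC⟩

end Systems

/-! ### Passage from the coefficient field to `K`. -/

section BaseChange

variable {F : Type*} [Field F] (K : Type*) [Field K] [Algebra F K] (L : Type*) [Field L]
  [Algebra F L] [Algebra K L] [IsScalarTower F K L] {n t k : ℕ}

theorem poly_map (hkt : k ≤ t) (A : Matrix (Fin n) (Fin t) F) (d : Fin t → ℕ)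
    (g : Fin n → MvPolynomial (Fin k) F) (j : Fin n) :
    poly hkt (A.map (algebraMap F K)) d (fun j => map (algebraMap F K) (g j)) j =
      map (algebraMap F K) (poly hkt A d g j) := by
  simp [poly, map_rename]

theorem zeros_map (f : Fin n → MvPolynomial (Fin t) F) :
    zeros L (fun j => map (algebraMap F K) (f j)) = zeros L f := by
  ext x
  simp [zeros, aeval_map_algebraMap]

theorem degeneracyLocus_map (f : Fin n → MvPolynomial (Fin t) F) :
    degeneracyLocus L (fun j => map (algebraMap F K) (f j)) = degeneracyLocus L f := by
  have hjac (x : Fin t → L) : jacobian (fun j => map (algebraMap F K) (f j)) x = jacobian f x := by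
    ext j i
    simp [jacobian, pderiv_map, aeval_map_algebraMap]
  ext x
  simp only [degeneracyLocus, zeros_map, hjac]

end BaseChange

theorem dim_loci_le_of_intermediateField {F L : Type*} [Field F] [Field L] [Algebra F L]
    [IsAlgClosure F L] {n t k : ℕ} (hk : 1 ≤ k) (hkt : k ≤ t) (hnt : n + k - 1 ≤ t) (hnt' : n ≤ t)
    (A : Matrix (Fin n) (Fin t) F) (d : Fin t → ℕ)
    (g : Fin n → MvPolynomial (Fin k) F) (hd : ∀ i, (d i : F) ≠ 0)
    (hg : ∀ j i, (g j).totalDegree < d i)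
    (hA : ∀ s : Fin n ↪o Fin t, (A.submatrix id s).rank = n) (K : IntermediateField F L) :
    dim K (degeneracyLocus L (poly hkt A d g)) ≤ ((k - 1 : ℕ) : WithBot ℕ∞) ∧
      dim K (singularLocus K (zeros L (poly hkt A d g))) ≤ ((k - 1 : ℕ) : WithBot ℕ∞) := by
  have : IsAlgClosed L := IsAlgClosure.isAlgClosed F
  have : Algebra.IsAlgebraic F L := IsAlgClosure.isAlgebraic
  have : Algebra.IsAlgebraic K L := Algebra.IsAlgebraic.tower_top (K := F) K
  have h := dim_loci_le (K := K) (L := L) hk hkt hnt hnt' (A.map (algebraMap F K)) d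
    (fun j => map (algebraMap F K) (g j)) ?_ ?_ ?_
  · simpa only [funext (poly_map K hkt A d g), zeros_map, degeneracyLocus_map] using h
  · intro i
    rw [← map_natCast (algebraMap F K)]
    exact (map_ne_zero _).2 (hd i)
  · intro j i
    exact (Finset.sup_mono (support_map_subset _ _)).trans_lt (hg j i)
  · intro s
    have := RingHom.map_det (algebraMap F K) (A.submatrix id s)
    rw [RingHom.mapMatrix_apply] at this
    rw [Matrix.submatrix_map, ← this]
    simpa using det_ne_zero_of_rank_eq (hA s)

end DiagonalSystem

open DiagonalSystem in
theorem mainTheorem10 {F L : Type*} [Field F] [Finite F] [Field L] [Algebra F L] [IsAlgClosure F L]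
    (n t k : ℕ) (hnt : 2 * n + 1 ≤ t) (hk : 1 ≤ k) (hkn : k ≤ n)
    (d : Fin t → ℕ) (hd : StrictAnti d) (hd2 : ∀ i, 2 ≤ d i) (hchar : ∀ i, ¬ ringChar F ∣ d i)
    (A : Matrix (Fin n) (Fin t) F)
    (hA : ∀ s : Fin n ↪o Fin t, (A.submatrix id s).rank = n)
    (g : Fin n → MvPolynomial (Fin k) F)
    (f : Fin n → MvPolynomial (Fin t) F) (hf : f = poly (by omega) A d g)
    -- the field of definition with respect to which varieties and dimensions are taken
    (K : IntermediateField F L) :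
    ((∀ j, 0 < (g j).totalDegree ∧ (g j).totalDegree < d ⟨t - 1, by omega⟩) →
      dim K (degeneracyLocus L f) ≤ ((k - 1 : ℕ) : WithBot ℕ∞) ∧
      dim K (singularLocus K (zeros L f)) ≤ ((k - 1 : ℕ) : WithBot ℕ∞)) ∧
    ((∀ j, ∃ c : F, g j = MvPolynomial.C c) →
      dim K (degeneracyLocus L f) ≤ 0 ∧
      dim K (singularLocus K (zeros L f)) ≤ 0) := by
  have hd0 (i) : (d i : F) ≠ 0 := fun h => hchar i ((ringChar.spec F (d i)).1 h)
  subst hf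
  refine ⟨fun hg => ?_, fun hg => ?_⟩
  · refine dim_loci_le_of_intermediateField hk _ (by omega) (by omega) A d g hd0 (fun j i => ?_) hA K
    refine (hg j).2.trans_le (hd.antitone ?_)
    rw [Fin.le_def]
    exact Nat.le_sub_one_of_lt i.2
  · choose c hc using hg
    -- Constants may be read as polynomials in one variable, so the bound `k - 1` becomes `0`.
    have hpoly : poly (show k ≤ t by omega) A d g =
        poly (show 1 ≤ t by omega) A d (fun j => MvPolynomial.C (c j)) := by
      ext1 j
      simp [poly, hc j]
    rw [hpoly]
    refine dim_loci_le_of_intermediateField (k := 1) le_rfl _ (by omega) (by omega) A d _ hd0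
      (fun j i => ?_) hA K
    rw [MvPolynomial.totalDegree_C]
    exact lt_of_lt_of_le two_pos (hd2 i)
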